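/- All Hilbert spaces are complex. For a contraction $A\colon \mathcal{H}_1\to\mathcal{H}_2$ between Hilbert spaces let $D_A=(I-A^*A)^{1/2}$ be its defect operator and $\mathcal{D}_A=\overline{D_A\mathcal{H}_1}$ its defect space. For contractions $A,B\colon\mathcal{H}_1\to\mathcal{H}_2$ say that $A$ Shmul'yan dominates $B$ if $B=A+D_{A^*}XD_A$ for some bounded operator $X\colon\mathcal{D}_A\to\mathcal{D}_{A^*}$; the Shmul'yan part $\Delta_{\rm Sh}(A)$ is the set of all contractions $B\colon\mathcal{H}_1\to\mathcal{H}_2$ such that $A$ and $B$ Shmul'yan dominate each other. For separable Hilbert spaces $\mathcal{E},\mathcal{E}'$ let $H_1^\infty(\mathcal{E},\mathcal{E}')$ be the set of analytic functions $F$ on the open unit disc $\mathbb{D}$ whose values are contractions from $\mathcal{E}$ to $\mathcal{E}'$, let $H^2(\mathcal{E})$ be the Hardy space of functions $g(\lambda)=\sum_{n\ge 0}\lambda^n g_n$ ($\lambda\in\mathbb{D}$, $g_n\in\mathcal{E}$) with $\|g\|^2=\sum_n\|g_n\|^2<\infty$, and for $F\in H_1^\infty(\mathcal{E},\mathcal{E}')$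 let $T_F\colon H^2(\mathcal{E})\to H^2(\mathcal{E}')$ be the contraction $(T_Fg)(\lambda)=F(\lambda)g(\lambda)$. Say that $F\in H_1^\infty(\mathcal{E},\mathcal{E}')$ Shmul'yan–ter Horst dominates $G\in H_1^\infty(\mathcal{E},\mathcal{E}')$ if $T_F$ Shmul'yan dominates $T_G$. **Theorem.** Let $\mathcal{E},\mathcal{E}'$ be separable Hilbert spaces and let $T\colon\mathcal{E}\to\mathcal{E}'$ be a partial isometry (a bounded operator with $TT^*T=T$). Then the constant function $\lambda\mapsto T$ in $H_1^\infty(\mathcal{E},\mathcal{E}')$ Shmul'yan–ter Horst dominates every $G\in H_1^\infty(\mathcal{E},\mathcal{E}')$ with $G(\mathbb{D})\subset\Delta_{\rm Sh}(T)$. -/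

import Mathlib

open scoped InnerProductSpace

noncomputable section

/-! ### Defect operators and the Shmul'yan pre-order -/

section Shmulyan

variable {H₁ H₂ : Type*}
  [NormedAddCommGroup H₁] [InnerProductSpace ℂ H₁] [CompleteSpace H₁]
  [NormedAddCommGroup H₂] [InnerProductSpace ℂ H₂] [CompleteSpace H₂]

/-- `T` is a partial isometry: `T T* T = T`. -/
def IsPartialIsometry (T : H₁ →L[ℂ] H₂) : Prop :=
  T ∘L ContinuousLinearMap.adjoint T ∘L T = T

/-- The defect operator `D_T = (I - T* T)^{1/2}` of a contraction `T`. -/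
def defectOp (T : H₁ →L[ℂ] H₂) : H₁ →L[ℂ] H₁ :=
  CFC.sqrt (ContinuousLinearMap.id ℂ H₁ - ContinuousLinearMap.adjoint T ∘L T)

/-- The defect space of `T`: the closure of the range of `D_T`. -/
def defectSpace (T : H₁ →L[ℂ] H₂) : Submodule ℂ H₁ :=
  (LinearMap.range (defectOp T).toLinearMap).topologicalClosure

theorem defectOp_mem_defectSpace (T : H₁ →L[ℂ] H₂) (h : H₁) :
    defectOp T h ∈ defectSpace T :=
  Submodule.le_topologicalClosure _ ⟨h, rfl⟩

/-- `D_T` as an operator from `H₁` into the defect space. -/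
def defectOpInto (T : H₁ →L[ℂ] H₂) : H₁ →L[ℂ] defectSpace T :=
  (defectOp T).codRestrict (defectSpace T) (defectOp_mem_defectSpace T)

/-- `D_T` as an operator from the defect space into `H₁`. -/
def defectOpFrom (T : H₁ →L[ℂ] H₂) : defectSpace T →L[ℂ] H₁ :=
  defectOp T ∘L (defectSpace T).subtypeL

/-- `ShmulyanDominated B A`: the contraction `B` is Shmul'yan dominated by the contraction `A`,
i.e. `B = A + D_{A*} X D_A` for a bounded operator `X` between the defect spaces. -/
def ShmulyanDominated (B A : H₁ →L[ℂ] H₂) : Prop :=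
  ‖A‖ ≤ 1 ∧ ‖B‖ ≤ 1 ∧
    ∃ X : defectSpace A →L[ℂ] defectSpace (ContinuousLinearMap.adjoint A),
      B = A + defectOpFrom (ContinuousLinearMap.adjoint A) ∘L X ∘L defectOpInto A

/-- The Shmul'yan part of `T`: the contractions Shmul'yan equivalent to `T`. -/
def shmulyanPart (T : H₁ →L[ℂ] H₂) : Set (H₁ →L[ℂ] H₂) :=
  {B | ShmulyanDominated B T ∧ ShmulyanDominated T B}

theorem IsPartialIsometry.norm_le_one {T : H₁ →L[ℂ] H₂} (hT : IsPartialIsometry T) :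
    ‖T‖ ≤ 1 := by
  by_contra! h
  have h1 : ‖T‖ * ‖T‖ ≤ ‖T‖ := by
    rw [← ContinuousLinearMap.norm_adjoint_comp_self]
    have h2 : (ContinuousLinearMap.adjoint T ∘L T) ∘L (ContinuousLinearMap.adjoint T ∘L T)
        = ContinuousLinearMap.adjoint T ∘L T := by
      rw [ContinuousLinearMap.comp_assoc]
      exact congrArg _ hT
    have h3 := ContinuousLinearMap.norm_adjoint_comp_self (ContinuousLinearMap.adjoint T ∘L T)
    rw [ContinuousLinearMap.adjoint_comp, ContinuousLinearMap.adjoint_adjoint, h2] at h3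
    nlinarith [norm_nonneg (ContinuousLinearMap.adjoint T ∘L T),
      ContinuousLinearMap.norm_adjoint_comp_self T]
  nlinarith

end Shmulyan

/-! ### Vector-valued Hardy space -/

section Hardy

/-- The Hardy space `H²(E)` on the unit disc. An element `g` is given by its square-summable
sequence of Taylor coefficients `g n`; as a function on the disc it is `hardyEval g`.
The norm is `‖g‖² = ∑ ‖g n‖²`. -/
abbrev HardySpace (E : Type*) [NormedAddCommGroup E] [InnerProductSpace ℂ E] : Type _ :=
  lp (fun _ : ℕ => E) 2

variable {E E' : Type*}
  [NormedAddCommGroup E] [InnerProductSpace ℂ E] [CompleteSpace E]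
  [NormedAddCommGroup E'] [InnerProductSpace ℂ E'] [CompleteSpace E']

/-- The analytic function on the unit disc represented by an element of `H²(E)`:
`g(z) = ∑ zⁿ gₙ`. -/
def hardyEval (g : HardySpace E) (z : ℂ) : E := ∑' n : ℕ, z ^ n • g n

theorem hardy_integral_fourier (n : ℤ) :
    ∫ x : UnitAddCircle, fourier n x ∂AddCircle.haarAddCircle = if n = 0 then 1 else 0 := by
  split_ifs with h
  · subst h
    simp
  · exact MeasureTheory.integral_eq_zero_of_add_right_eq_neg
      (fourier_add_half_inv_index h one_pos)

/-- Parseval's identity on the unit circle for absolutely summable coefficients. -/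
theorem hardy_parseval {a : ℕ → E} (ha : Summable fun n => ‖a n‖) :
    HasSum (fun n => ‖a n‖ ^ 2)
      (∫ x : UnitAddCircle, ‖∑' n : ℕ, (fourier 1 x) ^ n • a n‖ ^ 2
        ∂AddCircle.haarAddCircle) := by
  set μ : MeasureTheory.Measure UnitAddCircle := AddCircle.haarAddCircle with hμ
  have hw : ∀ x : UnitAddCircle, ‖fourier 1 x‖ = 1 := fun x => by
    rw [fourier_apply, Circle.norm_coe]
  have hwn : ∀ (x : UnitAddCircle) (n : ℕ), (fourier 1 x) ^ n = fourier (n : ℤ) x := by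
    intro x n
    induction n with
    | zero => simp
    | succ k ih => rw [pow_succ, ih, ← fourier_add]; push_cast; rfl
  have hnorm : ∀ (x : UnitAddCircle) (n : ℕ), ‖(fourier 1 x) ^ n • a n‖ = ‖a n‖ := by
    intro x n
    rw [norm_smul, norm_pow, hw, one_pow, one_mul]
  have hcontn : ∀ n : ℕ, Continuous fun x : UnitAddCircle => (fourier 1 x) ^ n • a n :=
    fun n => ((map_continuous (fourier 1)).pow n).smul continuous_const
  set f : UnitAddCircle → E := fun x => ∑' n : ℕ, (fourier 1 x) ^ n • a n with hf
  have hfc : Continuous f :=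
    continuous_tsum hcontn ha fun n x => (hnorm x n).le
  have hint : ∀ {V : Type _} [NormedAddCommGroup V] {g : UnitAddCircle → V}, Continuous g →
      MeasureTheory.Integrable g μ := fun hg =>
    hg.integrable_of_hasCompactSupport (HasCompactSupport.of_compactSpace _)
  have hsumf : ∀ x, HasSum (fun n : ℕ => (fourier 1 x) ^ n • a n) (f x) := fun x =>
    (Summable.of_norm (by simpa only [hnorm] using ha)).hasSum
  -- Fourier coefficients of `f`
  have hcoef : ∀ n : ℕ, ∫ x, ((starRingEnd ℂ) (fourier 1 x ^ n)) • f x ∂μ = a n := by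
    intro n
    have h1 : HasSum (fun m : ℕ => ∫ x, ((starRingEnd ℂ) (fourier 1 x ^ n)) •
        ((fourier 1 x) ^ m • a m) ∂μ) (∫ x, ((starRingEnd ℂ) (fourier 1 x ^ n)) • f x ∂μ) := by
      refine MeasureTheory.hasSum_integral_of_dominated_convergence (fun m _ => ‖a m‖) ?_ ?_ ?_ ?_ ?_
      · intro m
        refine Continuous.aestronglyMeasurable ?_
        exact (Complex.continuous_conj.comp ((map_continuous (fourier 1)).pow n)).smul (hcontn m)
      · intro m
        refine Filter.Eventually.of_forall fun x => ?_
        rw [norm_smul, hnorm, RCLike.norm_conj, norm_pow, hw, one_pow, one_mul]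
      · exact Filter.Eventually.of_forall fun x => ha
      · exact MeasureTheory.integrable_const _
      · exact Filter.Eventually.of_forall fun x => (hsumf x).const_smul _
    have h2 : ∀ m : ℕ, ∫ x, ((starRingEnd ℂ) (fourier 1 x ^ n)) •
        ((fourier 1 x) ^ m • a m) ∂μ = if m = n then a n else 0 := by
      intro m
      have h3 : ∀ x : UnitAddCircle, ((starRingEnd ℂ) (fourier 1 x ^ n)) •
          ((fourier 1 x) ^ m • a m) = (fourier (-(n : ℤ) + m) x : ℂ) • a m := by
        intro x
        rw [hwn, hwn, ← fourier_neg, smul_smul, ← fourier_add]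
      simp_rw [h3]
      rw [integral_smul_const, hardy_integral_fourier]
      by_cases hmn : m = n
      · subst hmn; simp
      · rw [if_neg (by omega), if_neg hmn, zero_smul]
    simp_rw [h2] at h1
    exact h1.unique (hasSum_ite_eq n (a n))
  -- expand the squared norm
  have hexp : HasSum (fun n : ℕ => ∫ x, ⟪(fourier 1 x) ^ n • a n, f x⟫_ℂ ∂μ)
      (∫ x, ⟪f x, f x⟫_ℂ ∂μ) := by
    have hb : ∀ x, ‖f x‖ ≤ ∑' n, ‖a n‖ := fun x =>
      (norm_tsum_le_tsum_norm (by simpa only [hnorm] using ha)).trans_eq (by simp only [hnorm])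
    refine MeasureTheory.hasSum_integral_of_dominated_convergence
      (fun m _ => ‖a m‖ * ∑' n, ‖a n‖) ?_ ?_ ?_ ?_ ?_
    · intro m
      exact ((hcontn m).inner hfc).aestronglyMeasurable
    · intro m
      refine Filter.Eventually.of_forall fun x => (norm_inner_le_norm _ _).trans ?_
      rw [hnorm]
      exact mul_le_mul_of_nonneg_left (hb x) (norm_nonneg _)
    · exact Filter.Eventually.of_forall fun x => ha.mul_right _
    · exact MeasureTheory.integrable_const _
    · refine Filter.Eventually.of_forall fun x => ?_
      have h5 := (hsumf x).mapL (innerSLFlip ℂ (f x))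
      simpa [mul_comm] using h5
  have hterm : ∀ n : ℕ, ∫ x, ⟪(fourier 1 x) ^ n • a n, f x⟫_ℂ ∂μ = ((‖a n‖ ^ 2 : ℝ) : ℂ) := by
    intro n
    have h4 : ∀ x, ⟪(fourier 1 x) ^ n • a n, f x⟫_ℂ
        = ⟪a n, ((starRingEnd ℂ) (fourier 1 x ^ n)) • f x⟫_ℂ := by
      intro x
      rw [inner_smul_left, inner_smul_right]
    simp_rw [h4]
    rw [integral_inner, hcoef, inner_self_eq_norm_sq_to_K]
    · norm_cast
    · exact hint ((Complex.continuous_conj.comp ((map_continuous (fourier 1)).pow n)).smul hfc)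
  simp_rw [hterm, inner_self_eq_norm_sq_to_K] at hexp
  have h6 : (∫ x, ((‖f x‖ : ℂ)) ^ 2 ∂μ) = ((∫ x, ‖f x‖ ^ 2 ∂μ : ℝ) : ℂ) := by
    rw [← integral_complex_ofReal]
    push_cast
    rfl
  erw [h6] at hexp
  exact_mod_cast hexp

theorem hardy_summable_norm {c : ℕ → E} (hc : ∀ z ∈ Metric.ball (0 : ℂ) 1,
    Summable fun n : ℕ => z ^ n • c n) {r : ℝ} (hr0 : 0 ≤ r) (hr1 : r < 1) :
    Summable fun n : ℕ => ‖(r : ℂ) ^ n • c n‖ := by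
  obtain ⟨ρ, hrρ, hρ1⟩ := exists_between hr1
  have hρ0 : 0 < ρ := hr0.trans_lt hrρ
  have hs := hc (ρ : ℂ) (by simpa [abs_of_pos hρ0] using hρ1)
  obtain ⟨C, hC⟩ := hs.tendsto_atTop_zero.norm.bddAbove_range
  have hgeo : Summable fun n : ℕ => (r / ρ) ^ n :=
    summable_geometric_of_lt_one (by positivity) ((div_lt_one hρ0).2 hrρ)
  refine Summable.of_nonneg_of_le (fun n => norm_nonneg _) (fun n => ?_) (hgeo.mul_right C)
  have h1 : ‖(ρ : ℂ) ^ n • c n‖ ≤ C := hC ⟨n, rfl⟩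
  have h2 : ‖(r : ℂ) ^ n • c n‖ = (r / ρ) ^ n * ‖(ρ : ℂ) ^ n • c n‖ := by
    rw [norm_smul, norm_smul, norm_pow, norm_pow, Complex.norm_real, Complex.norm_real,
      Real.norm_of_nonneg hr0, Real.norm_of_nonneg hρ0.le, div_pow]
    field_simp
  rw [h2]
  gcongr

theorem hardyEval_hasSum (g : HardySpace E) {z : ℂ} (hz : z ∈ Metric.ball (0 : ℂ) 1) :
    HasSum (fun n : ℕ => z ^ n • g n) (hardyEval g z) := by
  have hz' : ‖z‖ < 1 := by simpa using hz
  refine Summable.hasSum (Summable.of_norm_bounded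
    ((summable_geometric_of_lt_one (norm_nonneg z) hz').mul_right ‖g‖) fun n => ?_)
  rw [norm_smul, norm_pow]
  gcongr
  exact lp.norm_apply_le_norm two_ne_zero g n

theorem hardyEval_differentiableOn (g : HardySpace E) :
    DifferentiableOn ℂ (hardyEval g) (Metric.ball (0 : ℂ) 1) := by
  intro z hz
  have hz' : ‖z‖ < 1 := by simpa using hz
  obtain ⟨r, hzr, hr1⟩ := exists_between hz'
  have hr0 : 0 ≤ r := (norm_nonneg z).trans hzr.le
  have h : DifferentiableOn ℂ (hardyEval g) (Metric.ball (0 : ℂ) r) := by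
    refine Complex.differentiableOn_tsum_of_summable_norm
      ((summable_geometric_of_lt_one hr0 hr1).mul_right ‖g‖) (fun n => ?_) Metric.isOpen_ball
      fun n w hw => ?_
    · exact ((differentiable_id.pow n).smul_const (g n)).differentiableOn
    · have hw' : ‖w‖ < r := by simpa using hw
      rw [norm_smul, norm_pow]
      gcongr
      exact lp.norm_apply_le_norm two_ne_zero g n
  exact (h.differentiableAt (Metric.isOpen_ball.mem_nhds (by simpa using hzr)))
    |>.differentiableWithinAt

/-- A power series that is pointwise dominated by a function of `H²` has square-summable
coefficients, with the corresponding norm estimate. -/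
theorem hardy_sum_le {c : ℕ → E'} {h : ℂ → E'} (g : HardySpace E)
    (hc : ∀ z ∈ Metric.ball (0 : ℂ) 1, HasSum (fun n : ℕ => z ^ n • c n) (h z))
    (hh : ∀ z ∈ Metric.ball (0 : ℂ) 1, ‖h z‖ ≤ ‖hardyEval g z‖) (s : Finset ℕ) :
    ∑ n ∈ s, ‖c n‖ ^ 2 ≤ ‖g‖ ^ 2 := by
  have hg2 : HasSum (fun n => ‖g n‖ ^ 2) (‖g‖ ^ 2) := by
    simpa using lp.hasSum_norm (p := 2) (by norm_num) g
  have key : ∀ r : ℝ, 0 ≤ r → r < 1 → ∑ n ∈ s, ‖(r : ℂ) ^ n • c n‖ ^ 2 ≤ ‖g‖ ^ 2 := by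
    intro r hr0 hr1
    have hw : ∀ x : UnitAddCircle, (r : ℂ) * fourier 1 x ∈ Metric.ball (0 : ℂ) 1 := by
      intro x
      rw [mem_ball_zero_iff, norm_mul, fourier_apply, Circle.norm_coe, Complex.norm_real,
        Real.norm_of_nonneg hr0, mul_one]
      exact hr1
    have hsc := hardy_summable_norm (fun z hz => (hc z hz).summable) hr0 hr1
    have hsg := hardy_summable_norm (fun z hz => (hardyEval_hasSum g hz).summable) hr0 hr1
    have hc1 := hardy_parseval hsc
    have hg1 := hardy_parseval hsg
    have e1 : ∀ x : UnitAddCircle, ∑' n : ℕ, (fourier 1 x) ^ n • ((r : ℂ) ^ n • c n)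
        = h (r * fourier 1 x) := fun x => by
      rw [← (hc _ (hw x)).tsum_eq]
      exact tsum_congr fun n => by rw [smul_smul, mul_pow, mul_comm]
    have e2 : ∀ x : UnitAddCircle, ∑' n : ℕ, (fourier 1 x) ^ n • ((r : ℂ) ^ n • g n)
        = hardyEval g (r * fourier 1 x) := fun x => by
      rw [← (hardyEval_hasSum g (hw x)).tsum_eq]
      exact tsum_congr fun n => by rw [smul_smul, mul_pow, mul_comm]
    simp_rw [e1] at hc1
    simp_rw [e2] at hg1
    have hle1 : (∫ x : UnitAddCircle, ‖h (r * fourier 1 x)‖ ^ 2 ∂AddCircle.haarAddCircle)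
        ≤ ∫ x : UnitAddCircle, ‖hardyEval g (r * fourier 1 x)‖ ^ 2
          ∂AddCircle.haarAddCircle := by
      refine MeasureTheory.integral_mono_of_nonneg
        (Filter.Eventually.of_forall fun x => by positivity) ?_
        (Filter.Eventually.of_forall fun x => ?_)
      · refine Continuous.integrable_of_hasCompactSupport ?_ (HasCompactSupport.of_compactSpace _)
        refine (Continuous.norm ?_).pow 2
        exact (hardyEval_differentiableOn g).continuousOn.comp_continuous
          (continuous_const.mul (map_continuous (fourier 1))) hw
      · have := hh _ (hw x)
        dsimp only
        gcongr
    have hle2 : (∫ x : UnitAddCircle, ‖hardyEval g (r * fourier 1 x)‖ ^ 2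
          ∂AddCircle.haarAddCircle) ≤ ‖g‖ ^ 2 := by
      refine hasSum_le (fun n => ?_) hg1 hg2
      rw [norm_smul, norm_pow, Complex.norm_real, Real.norm_of_nonneg hr0]
      gcongr
      exact mul_le_of_le_one_left (norm_nonneg _) (pow_le_one₀ hr0 hr1.le)
    exact (sum_le_hasSum s (fun n _ => by positivity) hc1).trans (hle1.trans hle2)
  have hcont : Continuous fun r : ℝ => ∑ n ∈ s, ‖(r : ℂ) ^ n • c n‖ ^ 2 := by fun_prop
  have hlim : Filter.Tendsto (fun r : ℝ => ∑ n ∈ s, ‖(r : ℂ) ^ n • c n‖ ^ 2)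
      (nhdsWithin 1 (Set.Iio 1)) (nhds (∑ n ∈ s, ‖c n‖ ^ 2)) := by
    have := (hcont.tendsto 1).mono_left (nhdsWithin_le_nhds (s := Set.Iio 1))
    simpa using this
  refine le_of_tendsto hlim ?_
  filter_upwards [Ioo_mem_nhdsLT (zero_lt_one' ℝ)] with r hr
  exact key r hr.1.le hr.2

/-- An element of `H²(E)` is determined by its values on the disc. -/
theorem hardyEval_ext {f g : HardySpace E}
    (h : ∀ z ∈ Metric.ball (0 : ℂ) 1, hardyEval f z = hardyEval g z) : f = g := by
  have hs : ∀ z ∈ Metric.ball (0 : ℂ) 1,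
      HasSum (fun n : ℕ => z ^ n • (f n - g n)) ((fun _ : ℂ => (0 : E)) z) := by
    intro z hz
    have := (hardyEval_hasSum f hz).sub (hardyEval_hasSum g hz)
    simpa only [h z hz, sub_self, smul_sub] using this
  have h0 := hardy_sum_le (0 : HardySpace E) hs (fun z _ => by simp)
  refine lp.ext (funext fun n => ?_)
  have h1 := h0 {n}
  rw [Finset.sum_singleton, norm_zero] at h1
  have h2 : ‖f n - g n‖ = 0 := by
    nlinarith [norm_nonneg (f n - g n)]
  exact sub_eq_zero.1 (norm_eq_zero.1 h2)

theorem hardyEval_add (f g : HardySpace E) {z : ℂ} (hz : z ∈ Metric.ball (0 : ℂ) 1) :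
    hardyEval (f + g) z = hardyEval f z + hardyEval g z := by
  refine (hardyEval_hasSum (f + g) hz).unique ?_
  simpa only [lp.coeFn_add, Pi.add_apply, smul_add] using
    (hardyEval_hasSum f hz).add (hardyEval_hasSum g hz)

theorem hardyEval_smul (a : ℂ) (g : HardySpace E) {z : ℂ} (hz : z ∈ Metric.ball (0 : ℂ) 1) :
    hardyEval (a • g) z = a • hardyEval g z := by
  refine (hardyEval_hasSum (a • g) hz).unique ?_
  have h := (hardyEval_hasSum g hz).const_smul a
  simp_rw [smul_comm a] at h
  exact h

end Hardy

/-! ### The operator-valued Schur class and Toeplitz operators -/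

section Schur

/-- The Schur class `H₁^∞(E, E')`: analytic functions on the open unit disc whose values are
contractions from `E` to `E'`. (Values of `toFun` outside the disc play no role.) -/
structure SchurClass (E E' : Type*)
    [NormedAddCommGroup E] [InnerProductSpace ℂ E] [CompleteSpace E]
    [NormedAddCommGroup E'] [InnerProductSpace ℂ E'] [CompleteSpace E'] where
  toFun : ℂ → E →L[ℂ] E'
  analytic : DifferentiableOn ℂ toFun (Metric.ball (0 : ℂ) 1)
  norm_le_one : ∀ z ∈ Metric.ball (0 : ℂ) 1, ‖toFun z‖ ≤ 1

variable {E E' : Type*}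
  [NormedAddCommGroup E] [InnerProductSpace ℂ E] [CompleteSpace E]
  [NormedAddCommGroup E'] [InnerProductSpace ℂ E'] [CompleteSpace E']

/-- A contraction viewed as a constant function in the Schur class. -/
def SchurClass.const (T : E →L[ℂ] E') (hT : ‖T‖ ≤ 1) : SchurClass E E' where
  toFun := fun _ => T
  analytic := differentiableOn_const T
  norm_le_one := fun _ _ => hT

theorem SchurClass.exists_mul (F : SchurClass E E') (g : HardySpace E) :
    ∃ f : HardySpace E', ‖f‖ ≤ ‖g‖ ∧
      ∀ z ∈ Metric.ball (0 : ℂ) 1, hardyEval f z = F.toFun z (hardyEval g z) := by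
  have hd : DifferentiableOn ℂ (fun z => F.toFun z (hardyEval g z)) (Metric.ball (0 : ℂ) 1) :=
    F.analytic.clm_apply (hardyEval_differentiableOn g)
  set c : ℕ → E' := fun n =>
    ((n.factorial : ℂ)⁻¹) • iteratedDeriv n (fun z => F.toFun z (hardyEval g z)) 0 with hc
  have hs : ∀ z ∈ Metric.ball (0 : ℂ) 1,
      HasSum (fun n : ℕ => z ^ n • c n) (F.toFun z (hardyEval g z)) := by
    intro z hz
    have := Complex.hasSum_taylorSeries_on_ball hd hz
    convert this using 2 with n
    rw [sub_zero, smul_comm]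
  have hle := hardy_sum_le g hs fun z hz =>
    ((F.toFun z).le_opNorm _).trans
      (mul_le_of_le_one_left (norm_nonneg _) (F.norm_le_one z hz))
  have hmem : Memℓp c 2 := memℓp_gen' (C := ‖g‖ ^ 2) fun s => by simpa using hle s
  refine ⟨⟨c, hmem⟩, ?_, fun z hz => (hs z hz).tsum_eq⟩
  exact lp.norm_le_of_forall_sum_le (by norm_num) (norm_nonneg _) fun s => by simpa using hle s

/-- The Toeplitz (multiplication) operator `T_F : H²(E) → H²(E')`,
`(T_F g)(z) = F(z) g(z)` for `z` in the disc; see `hardyEval_toeplitz`. -/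
def toeplitz (F : SchurClass E E') : HardySpace E →L[ℂ] HardySpace E' :=
  LinearMap.mkContinuous
    { toFun := fun g => (F.exists_mul g).choose
      map_add' := fun f g => hardyEval_ext fun z hz => by
        rw [hardyEval_add _ _ hz, (F.exists_mul (f + g)).choose_spec.2 z hz,
          (F.exists_mul f).choose_spec.2 z hz, (F.exists_mul g).choose_spec.2 z hz,
          hardyEval_add _ _ hz, map_add]
      map_smul' := fun a g => hardyEval_ext fun z hz => by
        rw [RingHom.id_apply, hardyEval_smul _ _ hz, (F.exists_mul (a • g)).choose_spec.2 z hz,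
          (F.exists_mul g).choose_spec.2 z hz, hardyEval_smul _ _ hz, map_smul] }
    1 fun g => by
      rw [one_mul]
      exact (F.exists_mul g).choose_spec.1

/-- The defining property of the Toeplitz operator; by `hardyEval_ext` it determines `T_F`. -/
theorem hardyEval_toeplitz (F : SchurClass E E') (g : HardySpace E) {z : ℂ}
    (hz : z ∈ Metric.ball (0 : ℂ) 1) :
    hardyEval (toeplitz F g) z = F.toFun z (hardyEval g z) :=
  (F.exists_mul g).choose_spec.2 z hz

theorem norm_toeplitz_le_one (F : SchurClass E E') : ‖toeplitz F‖ ≤ 1 :=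
  LinearMap.mkContinuous_norm_le _ zero_le_one _

/-- `F` is Shmul'yan-ter Horst dominated by `G`: `T_F` is Shmul'yan dominated by `T_G`. -/
def ShmulyanTerHorstDominated (F G : SchurClass E E') : Prop :=
  ShmulyanDominated (toeplitz F) (toeplitz G)

end Schur

end

/-!
For a partial isometry `T` the defect operators `D_T = I - T* T` and `D_{T*} = I - T T*` are
projections, so a contraction `B` is Shmul'yan dominated by `T` exactly when
`B - T = D_{T*} (B - T) D_T`, that is, when `T* B = T* T` and `B T* = T T*`. The multiplication
operator with the constant symbol `T` is again a partial isometry, with adjoint the multiplication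
by `T*`. Since `F ↦ T_F` is multiplicative and injective, the two identities hold for the
multiplication operators if and only if they hold for the symbols at every point of the disc.
-/

section PartialIsometry

open scoped InnerProduct

variable {H₁ H₂ V : Type*}
  [NormedAddCommGroup H₁] [InnerProductSpace ℂ H₁] [CompleteSpace H₁]
  [NormedAddCommGroup H₂] [InnerProductSpace ℂ H₂] [CompleteSpace H₂]
  [NormedAddCommGroup V] [NormedSpace ℂ V]
  {T A B : H₁ →L[ℂ] H₂}

namespace IsPartialIsometry

theorem adjoint (hT : IsPartialIsometry T) : IsPartialIsometry (T†) := by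
  simpa only [IsPartialIsometry, ContinuousLinearMap.adjoint_comp,
    ContinuousLinearMap.adjoint_adjoint, ContinuousLinearMap.comp_assoc] using
    congrArg ContinuousLinearMap.adjoint hT

theorem isStarProjection_adjoint_comp_self (hT : IsPartialIsometry T) :
    IsStarProjection (T† ∘L T) where
  isIdempotentElem := congrArg (T† ∘L ·) hT
  isSelfAdjoint := (ContinuousLinearMap.isPositive_adjoint_comp_self T).isSelfAdjoint

theorem defectOp_eq (hT : IsPartialIsometry T) :
    defectOp T = ContinuousLinearMap.id ℂ H₁ - T† ∘L T :=
  have hP := hT.isStarProjection_adjoint_comp_self.one_sub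
  CFC.sqrt_unique hP.isIdempotentElem hP.nonneg

theorem comp_defectOp (hT : IsPartialIsometry T) : T ∘L defectOp T = 0 := by
  rw [hT.defectOp_eq, ContinuousLinearMap.comp_sub, hT, ContinuousLinearMap.comp_id, sub_self]

theorem defectOp_comp_adjoint (hT : IsPartialIsometry T) : defectOp T ∘L T† = 0 := by
  have hT' : T† ∘L T ∘L T† = T† := by
    simpa only [IsPartialIsometry, ContinuousLinearMap.adjoint_adjoint] using hT.adjoint
  rw [hT.defectOp_eq, ContinuousLinearMap.sub_comp, ContinuousLinearMap.comp_assoc, hT',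
    ContinuousLinearMap.id_comp, sub_self]

theorem comp_defectOp_eq_self (hT : IsPartialIsometry T) {C : H₁ →L[ℂ] V}
    (hC : C ∘L T† = 0) : C ∘L defectOp T = C := by
  rw [hT.defectOp_eq, ContinuousLinearMap.comp_sub, ← ContinuousLinearMap.comp_assoc, hC,
    ContinuousLinearMap.zero_comp, ContinuousLinearMap.comp_id, sub_zero]

theorem defectOp_comp_eq_self (hT : IsPartialIsometry T) {C : V →L[ℂ] H₁}
    (hC : T ∘L C = 0) : defectOp T ∘L C = C := by
  rw [hT.defectOp_eq, ContinuousLinearMap.sub_comp, ContinuousLinearMap.comp_assoc, hC,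
    ContinuousLinearMap.comp_zero, ContinuousLinearMap.id_comp, sub_zero]

theorem adjoint_comp_eq_of_shmulyanDominated (hA : IsPartialIsometry A)
    (hBA : ShmulyanDominated B A) : A† ∘L B = A† ∘L A := by
  obtain ⟨-, -, X, rfl⟩ := hBA
  rw [ContinuousLinearMap.comp_add, add_eq_left, defectOpFrom, ContinuousLinearMap.comp_assoc,
    ← ContinuousLinearMap.comp_assoc, hA.adjoint.comp_defectOp, ContinuousLinearMap.zero_comp]

theorem comp_adjoint_eq_of_shmulyanDominated (hA : IsPartialIsometry A)
    (hBA : ShmulyanDominated B A) : B ∘L A† = A ∘L A† := by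
  obtain ⟨-, -, X, rfl⟩ := hBA
  have hinto : defectOpInto A ∘L A† = 0 :=
    ContinuousLinearMap.ext fun y => Subtype.ext (DFunLike.congr_fun hA.defectOp_comp_adjoint y)
  rw [ContinuousLinearMap.add_comp, add_eq_left, ContinuousLinearMap.comp_assoc,
    ContinuousLinearMap.comp_assoc, hinto, ContinuousLinearMap.comp_zero,
    ContinuousLinearMap.comp_zero]

theorem shmulyanDominated_of_comp_eq (hA : IsPartialIsometry A) (hB : ‖B‖ ≤ 1)
    (hleft : A† ∘L B = A† ∘L A) (hright : B ∘L A† = A ∘L A†) : ShmulyanDominated B A := by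
  have hD : (B - A) ∘L defectOp A = B - A :=
    hA.comp_defectOp_eq_self (by rw [ContinuousLinearMap.sub_comp, hright, sub_self])
  have hD' : defectOp (A†) ∘L (B - A) = B - A :=
    hA.adjoint.defectOp_comp_eq_self (by rw [ContinuousLinearMap.comp_sub, hleft, sub_self])
  refine ⟨hA.norm_le_one, hB, defectOpInto (A†) ∘L (B - A) ∘L (defectSpace A).subtypeL, ?_⟩
  calc B = A + (B - A) := (add_sub_cancel A B).symm
    _ = A + defectOp (A†) ∘L (defectOp (A†) ∘L (B - A)) ∘L defectOp A := by rw [hD', hD, hD']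
    _ = _ := rfl

theorem shmulyanDominated_iff (hA : IsPartialIsometry A) (hB : ‖B‖ ≤ 1) :
    ShmulyanDominated B A ↔ A† ∘L B = A† ∘L A ∧ B ∘L A† = A ∘L A† :=
  ⟨fun h => ⟨hA.adjoint_comp_eq_of_shmulyanDominated h,
      hA.comp_adjoint_eq_of_shmulyanDominated h⟩,
    fun h => hA.shmulyanDominated_of_comp_eq hB h.1 h.2⟩

end IsPartialIsometry

end PartialIsometry

section Toeplitz

open scoped InnerProduct

theorem hardyEval_single_zero {E : Type*} [NormedAddCommGroup E] [InnerProductSpace ℂ E]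
    (x : E) (z : ℂ) : hardyEval (lp.single 2 0 x) z = x := by
  rw [hardyEval, tsum_eq_single 0 fun n hn => by rw [lp.single_apply_ne _ _ _ hn, smul_zero],
    lp.single_apply_self, pow_zero, one_smul]

variable {E E' E'' : Type*}
  [NormedAddCommGroup E] [InnerProductSpace ℂ E] [CompleteSpace E]
  [NormedAddCommGroup E'] [InnerProductSpace ℂ E'] [CompleteSpace E']
  [NormedAddCommGroup E''] [InnerProductSpace ℂ E''] [CompleteSpace E'']

/-- The pointwise product `z ↦ F(z) G(z)` of two Schur class functions, the symbol of the product
`T_F T_G` of their multiplication operators. -/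
def SchurClass.comp (F : SchurClass E' E'') (G : SchurClass E E') : SchurClass E E'' where
  toFun z := F.toFun z ∘L G.toFun z
  analytic := F.analytic.clm_comp G.analytic
  norm_le_one z hz := (ContinuousLinearMap.opNorm_comp_le _ _).trans
    (mul_le_one₀ (F.norm_le_one z hz) (norm_nonneg _) (G.norm_le_one z hz))

theorem toeplitz_comp_toeplitz (F : SchurClass E' E'') (G : SchurClass E E') :
    toeplitz F ∘L toeplitz G = toeplitz (F.comp G) :=
  ContinuousLinearMap.ext fun g => hardyEval_ext fun z hz => by
    simp only [ContinuousLinearMap.comp_apply, hardyEval_toeplitz _ _ hz, SchurClass.comp]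

theorem toeplitz_eq_toeplitz_iff {F G : SchurClass E E'} :
    toeplitz F = toeplitz G ↔ ∀ z ∈ Metric.ball (0 : ℂ) 1, F.toFun z = G.toFun z := by
  refine ⟨fun h z hz => ContinuousLinearMap.ext fun x => ?_, fun h =>
    ContinuousLinearMap.ext fun g => hardyEval_ext fun z hz => ?_⟩
  · rw [← hardyEval_single_zero x z, ← hardyEval_toeplitz F _ hz, h, hardyEval_toeplitz G _ hz]
  · rw [hardyEval_toeplitz F g hz, hardyEval_toeplitz G g hz, h z hz]

theorem toeplitz_const_eq_mapCLM (T : E →L[ℂ] E') (hT : ‖T‖ ≤ 1) :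
    toeplitz (SchurClass.const T hT) = lp.mapCLM 2 (fun _ : ℕ => T) zero_le_one fun _ => hT := by
  refine ContinuousLinearMap.ext fun g => hardyEval_ext fun z hz => ?_
  rw [hardyEval_toeplitz _ g hz]
  refine HasSum.unique ?_ (hardyEval_hasSum _ hz)
  simpa only [map_smul, lp.mapCLM_apply_coe, SchurClass.const] using
    (hardyEval_hasSum g hz).mapL T

theorem adjoint_toeplitz_const (T : E →L[ℂ] E') (hT : ‖T‖ ≤ 1) (hT' : ‖T†‖ ≤ 1) :
    (toeplitz (SchurClass.const T hT))† = toeplitz (SchurClass.const (T†) hT') := by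
  rw [toeplitz_const_eq_mapCLM, toeplitz_const_eq_mapCLM, eq_comm,
    ContinuousLinearMap.eq_adjoint_iff]
  intro f g
  rw [lp.inner_eq_tsum, lp.inner_eq_tsum]
  exact tsum_congr fun n => T.adjoint_inner_left (g n) (f n)

theorem IsPartialIsometry.toeplitz_const {T : E →L[ℂ] E'} (hT : IsPartialIsometry T) :
    IsPartialIsometry (toeplitz (SchurClass.const T hT.norm_le_one)) := by
  rw [IsPartialIsometry, adjoint_toeplitz_const T _ hT.adjoint.norm_le_one,
    toeplitz_comp_toeplitz, toeplitz_comp_toeplitz, toeplitz_eq_toeplitz_iff]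
  exact fun _ _ => hT

end Toeplitz

theorem mainTheorem8_general {E E' : Type*}
    [NormedAddCommGroup E] [InnerProductSpace ℂ E] [CompleteSpace E]
    [NormedAddCommGroup E'] [InnerProductSpace ℂ E'] [CompleteSpace E']
    (T : E →L[ℂ] E') (hT : IsPartialIsometry T) (G : SchurClass E E') :
    ShmulyanTerHorstDominated G (SchurClass.const T hT.norm_le_one) ↔
      ∀ z ∈ Metric.ball (0 : ℂ) 1, ShmulyanDominated (G.toFun z) T := by
  rw [ShmulyanTerHorstDominated, hT.toeplitz_const.shmulyanDominated_iff (norm_toeplitz_le_one G),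
    adjoint_toeplitz_const T _ hT.adjoint.norm_le_one]
  simp only [toeplitz_comp_toeplitz, toeplitz_eq_toeplitz_iff, ← forall₂_and]
  exact forall₂_congr fun z hz => (hT.shmulyanDominated_iff (G.norm_le_one z hz)).symm

theorem mainTheorem8 {E E' : Type*}
    [NormedAddCommGroup E] [InnerProductSpace ℂ E] [CompleteSpace E]
    [TopologicalSpace.SeparableSpace E]
    [NormedAddCommGroup E'] [InnerProductSpace ℂ E'] [CompleteSpace E']
    [TopologicalSpace.SeparableSpace E']
    (T : E →L[ℂ] E') (hT : IsPartialIsometry T)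
    (G : SchurClass E E')
    (hG : ∀ z ∈ Metric.ball (0 : ℂ) 1, G.toFun z ∈ shmulyanPart T) :
    ShmulyanTerHorstDominated G (SchurClass.const T hT.norm_le_one) :=
  (mainTheorem8_general T hT G).2 fun z hz => (hG z hz).1
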